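/- For a finite subset $S$ of a group $\Gamma$, the multiset of differences of $S$ is $\{s t^{-1} : (s,t)\in S\times S\}$, and $S$ is a covering set of $\Gamma$ if every element of $\Gamma$ occurs in this multiset. If $\Gamma$ has order $n$ and $|S|=s$, then $S$ is an $(n,s,\lambda,t)$ almost difference set if exactly $t$ non-identity elements of $\Gamma$ occur exactly $\lambda$ times in the multiset of differences of $S$ and all the other non-identity elements occur exactly $\lambda+1$ times. Proposition. The maximum order of a finite non-Abelian group having a covering set of size $7$ is $40$; in particular, no non-Abelian group of order $42$ has a covering set of size $7$. The group $\Gamma_1=\langle a,b \mid a^5=b^8=1,\ bab^{-1}=a^2\rangle$ is non-Abelian of order $40$, and $S=\{1,b,b^4,ba,ba^{-1}b^2,ab^{-1},bab^2\}$ is a covering set of $\Gamma_1$ of size $7$ which is a $(40,7,1,36)$ almost difference set. Moreover, the set of inverses $\overline{S}=\{x^{-1} : x\in S\}$ is also a covering set of $\Gamma_1$. -/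

import Mathlib

universe u

namespace CoveringSets

/-- The multiset of differences `s * t⁻¹`, over all ordered pairs `(s, t)` of elements of `S`
(pairs with `s = t` included). -/
def differences {G : Type u} [Group G] (S : Finset G) : Multiset G :=
  (S ×ˢ S).val.map fun p => p.1 * p.2⁻¹

/-- `S` is a covering (difference) set of `G`: every element of `G` is a difference of
elements of `S`. -/
def IsCoveringSet {G : Type u} [Group G] (S : Finset G) : Prop :=
  ∀ g : G, g ∈ differences S

/-- The set of inverses of the elements of `S`. -/
def inverseSet {G : Type u} [Group G] (S : Finset G) : Finset G :=
  S.map (Equiv.inv G).toEmbedding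

/-- The group is not commutative. -/
def IsNonAbelian (G : Type u) [Group G] : Prop :=
  ∃ x y : G, x * y ≠ y * x

open Classical in
/-- `S` is an `(n, s, l, t)`-almost difference set of `G`: the group has order `n`, the set has
size `s`, exactly `t` nonidentity elements occur exactly `l` times in the multiset of differences,
and all other nonidentity elements occur exactly `l + 1` times. -/
structure IsAlmostDifferenceSet {G : Type u} [Group G] (S : Finset G) (n s l t : ℕ) : Prop where
  finite : Finite G
  order : Nat.card G = n
  size : S.card = s
  count_eq : {g : G | g ≠ 1 ∧ (differences S).count g = l}.ncard = t
  count_other : ∀ g : G, g ≠ 1 → (differences S).count g ≠ l → (differences S).count g = l + 1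

/-- The orders of the finite non-Abelian groups that have a covering set of size `s`. -/
def nonAbelianCoveringOrders (s : ℕ) : Set ℕ :=
  {n | ∃ (G : Type u) (_ : Group G), Finite G ∧ Nat.card G = n ∧ IsNonAbelian G ∧
    ∃ S : Finset G, S.card = s ∧ IsCoveringSet S}

/-- The relators of `⟨a, b | a ^ 5 = b ^ 8 = 1, b * a * b⁻¹ = a ^ 2⟩`; the free generators
`0` and `1` stand for `a` and `b`. -/
def gammaRels : Set (FreeGroup (Fin 2)) :=
  {FreeGroup.of 0 ^ 5, FreeGroup.of 1 ^ 8,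
    FreeGroup.of 1 * FreeGroup.of 0 * (FreeGroup.of 1)⁻¹ * (FreeGroup.of 0 ^ 2)⁻¹}

/-- The group `⟨a, b | a ^ 5 = b ^ 8 = 1, b * a * b⁻¹ = a ^ 2⟩`. -/
abbrev Gamma : Type := PresentedGroup gammaRels

/-- The generator `a`. -/
def a : Gamma := PresentedGroup.of 0

/-- The generator `b`. -/
def b : Gamma := PresentedGroup.of 1

open Classical in
/-- The set `{1, b, b⁴, ba, ba⁻¹b², ab⁻¹, bab²}`. -/
noncomputable def gammaSet : Finset Gamma :=
  {1, b, b ^ 4, b * a, b * a⁻¹ * b ^ 2, a * b⁻¹, b * a * b ^ 2}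

end CoveringSets

/-! Existence is a finite computation. The relations bring every element of `Gamma` to the form `a ^
m * b ^ n`, so `Gamma` is isomorphic to an explicit semidirect product `Model` of order 40, where
the claims about the set are decided.

For the bound, 7 elements give 42 ordered pairs of distinct elements, so the order is at most 43; 41
and 43 are prime, which forces commutativity. In order 42 those pairs must hit 41 nonidentity
elements. An involution is hit at least twice, by a pair and its swap, so there is a unique
involution `z`, hit twice, and all else is hit once (`IsCoveringSet.pairCount_eq`). Then `z` is
central and the quotient by the normal Sylow 7-subgroup is cyclic of order 6
(`exists_hom_zmod_six`). The sizes of the parts of `S` over `ZMod 6` have prescribed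
autocorrelations, which no integers satisfy (`not_sum_sq_eq_five`). -/

namespace CoveringSets

/-! ### The explicit model of order 40 -/

/-- The powers of `2` modulo `5`, indexed by exponents modulo `8`. -/
def twoPow (i : ZMod 8) : ZMod 5 := 2 ^ i.val

theorem twoPow_add : ∀ i j : ZMod 8, twoPow (i + j) = twoPow i * twoPow j := by decide

theorem twoPow_zero : twoPow 0 = 1 := by decide

/-- The semidirect product of `ℤ/5` by `ℤ/8`, a generator of which acts as doubling. -/
@[ext] structure Model where
  /-- The component in the normal subgroup. -/
  left : ZMod 5
  /-- The component in the complement. -/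
  right : ZMod 8

namespace Model

/-- Elements of the model are pairs. -/
def equivProd : Model ≃ ZMod 5 × ZMod 8 where
  toFun g := (g.left, g.right)
  invFun p := ⟨p.1, p.2⟩
  left_inv _ := rfl
  right_inv _ := rfl

instance : DecidableEq Model := fun x y =>
  decidable_of_iff (x.left = y.left ∧ x.right = y.right) Model.ext_iff.symm

instance : Fintype Model := Fintype.ofEquiv _ equivProd.symm

instance : Mul Model := ⟨fun x y => ⟨x.left + twoPow x.right * y.left, x.right + y.right⟩⟩

instance : One Model := ⟨⟨0, 0⟩⟩

instance : Inv Model := ⟨fun x => ⟨-(twoPow (-x.right) * x.left), -x.right⟩⟩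

theorem mul_def (x y : Model) :
    x * y = ⟨x.left + twoPow x.right * y.left, x.right + y.right⟩ := rfl

theorem one_def : (1 : Model) = ⟨0, 0⟩ := rfl

theorem inv_def (x : Model) : x⁻¹ = ⟨-(twoPow (-x.right) * x.left), -x.right⟩ := rfl

instance : Group Model := Group.ofLeftAxioms
  (fun x y z => by
    simp only [mul_def, twoPow_add, Model.mk.injEq]
    constructor <;> ring)
  (fun x => by simp [mul_def, one_def, twoPow_zero])
  (fun x => by simp [mul_def, one_def, inv_def])

theorem card_eq : Nat.card Model = 40 := by
  rw [Nat.card_congr equivProd, Nat.card_prod, Nat.card_zmod, Nat.card_zmod]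

/-- The image of `a`. -/
def genA : Model := ⟨1, 0⟩

/-- The image of `b`. -/
def genB : Model := ⟨0, 1⟩

/-- The image of `gammaSet`. -/
def coverSet : Finset Model :=
  {1, genB, genB ^ 4, genB * genA, genB * genA⁻¹ * genB ^ 2, genA * genB⁻¹,
    genB * genA * genB ^ 2}

theorem genA_pow_mul_genB_pow :
    ∀ x : ZMod 5, ∀ y : ZMod 8, genA ^ x.val * genB ^ y.val = ⟨x, y⟩ := by decide +kernel

end Model

open Model

/-! ### Isomorphism of the presented group with the model -/

/-- The values of the generators in the model. -/
def modelGen : Fin 2 → Model := ![genA, genB]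

theorem modelGen_rels : ∀ r ∈ gammaRels, FreeGroup.lift modelGen r = 1 := by
  intro r hr
  simp only [gammaRels, Set.mem_insert_iff, Set.mem_singleton_iff] at hr
  rcases hr with rfl | rfl | rfl <;>
    simp only [map_mul, map_pow, map_inv, FreeGroup.lift_apply_of] <;> decide +kernel

/-- The homomorphism from the presented group to its model. -/
def toModel : Gamma →* Model := PresentedGroup.toGroup modelGen_rels

theorem toModel_a : toModel a = genA := PresentedGroup.toGroup.of modelGen_rels

theorem toModel_b : toModel b = genB := PresentedGroup.toGroup.of modelGen_rels

theorem a_pow_five : a ^ 5 = 1 :=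
  PresentedGroup.one_of_mem (rels := gammaRels) (x := FreeGroup.of 0 ^ 5) (by simp [gammaRels])

theorem b_pow_eight : b ^ 8 = 1 :=
  PresentedGroup.one_of_mem (rels := gammaRels) (x := FreeGroup.of 1 ^ 8) (by simp [gammaRels])

theorem b_mul_a : b * a = a ^ 2 * b := by
  have h : b * a * b⁻¹ * (a ^ 2)⁻¹ = 1 :=
    PresentedGroup.one_of_mem (rels := gammaRels)
      (x := FreeGroup.of 1 * FreeGroup.of 0 * (FreeGroup.of 1)⁻¹ * (FreeGroup.of 0 ^ 2)⁻¹)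
      (by simp [gammaRels])
  rw [mul_inv_eq_one] at h
  rw [← h]
  group

theorem b_mul_a_pow (n : ℕ) : b * a ^ n = a ^ (2 * n) * b := by
  induction n with
  | zero => simp
  | succ n ih => rw [pow_succ, ← mul_assoc, ih, mul_assoc, b_mul_a, ← mul_assoc, ← pow_add]; rfl

/-- Left multiplication by a generator or its inverse preserves this normal form, since `b` moves
past powers of `a` by doubling the exponent and the inverses are `a ^ 4` and `b ^ 7`. -/
theorem exists_pow_mul_pow (g : Gamma) : ∃ m n : ℕ, g = a ^ m * b ^ n := by
  have hinv : ∀ m n : ℕ, ∃ m' n' : ℕ, b * (a ^ m * b ^ n) = a ^ m' * b ^ n' := fun m n =>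
    ⟨2 * m, n + 1, by rw [← mul_assoc, b_mul_a_pow, mul_assoc, ← pow_succ']⟩
  have hpow : ∀ k m n : ℕ, ∃ m' n' : ℕ, b ^ k * (a ^ m * b ^ n) = a ^ m' * b ^ n' := by
    intro k
    induction k with
    | zero => exact fun m n => ⟨m, n, by simp⟩
    | succ k ih =>
      intro m n
      obtain ⟨m', n', h⟩ := hinv m n
      obtain ⟨m'', n'', h'⟩ := ih m' n'
      exact ⟨m'', n'', by rw [pow_succ, mul_assoc, h, h']⟩
  have ha : a⁻¹ = a ^ 4 := inv_eq_of_mul_eq_one_right (by rw [← pow_succ', a_pow_five])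
  have hb : b⁻¹ = b ^ 7 := inv_eq_of_mul_eq_one_right (by rw [← pow_succ', b_pow_eight])
  have hg : g ∈ Subgroup.closure (Set.range (PresentedGroup.of (rels := gammaRels))) := by
    rw [PresentedGroup.closure_range_of]; trivial
  induction hg using Subgroup.closure_induction_left with
  | one => exact ⟨0, 0, by simp⟩
  | mul_left x hx y _ ih =>
    obtain ⟨i, rfl⟩ := hx
    obtain ⟨m, n, rfl⟩ := ih
    fin_cases i
    · exact ⟨m + 1, n, by rw [pow_succ', mul_assoc]; rfl⟩
    · exact hinv m n
  | inv_mul_cancel x hx y _ ih =>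
    obtain ⟨i, rfl⟩ := hx
    obtain ⟨m, n, rfl⟩ := ih
    fin_cases i
    · exact ⟨4 + m, n, by rw [pow_add, mul_assoc, ← ha]; rfl⟩
    · change ∃ m' n', b⁻¹ * _ = _
      rw [hb]
      exact hpow 7 m n

theorem exists_zmod_pow (g : Gamma) : ∃ x : ZMod 5, ∃ y : ZMod 8, g = a ^ x.val * b ^ y.val := by
  obtain ⟨m, n, rfl⟩ := exists_pow_mul_pow g
  refine ⟨m, n, ?_⟩
  rw [ZMod.val_natCast, ZMod.val_natCast, ← pow_eq_pow_mod m a_pow_five,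
    ← pow_eq_pow_mod n b_pow_eight]

theorem toModel_pow (x : ZMod 5) (y : ZMod 8) : toModel (a ^ x.val * b ^ y.val) = ⟨x, y⟩ := by
  rw [map_mul, map_pow, map_pow, toModel_a, toModel_b, genA_pow_mul_genB_pow]

theorem toModel_bijective : Function.Bijective toModel := by
  constructor
  · intro g h hgh
    obtain ⟨x, y, rfl⟩ := exists_zmod_pow g
    obtain ⟨x', y', rfl⟩ := exists_zmod_pow h
    rw [toModel_pow, toModel_pow] at hgh
    cases hgh
    rfl
  · exact fun m => ⟨_, toModel_pow m.left m.right⟩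

/-- The presented group is isomorphic to its model. -/
noncomputable def gammaEquiv : Gamma ≃* Model := MulEquiv.ofBijective toModel toModel_bijective

/-! ### Transport along isomorphisms and the computed properties of the set -/

theorem mem_differences {G : Type u} [Group G] {S : Finset G} {g : G} :
    g ∈ differences S ↔ ∃ s ∈ S, ∃ t ∈ S, s * t⁻¹ = g := by
  simp only [differences, Multiset.mem_map, Finset.mem_val, Finset.mem_product, Prod.exists]
  constructor
  · rintro ⟨s, t, ⟨hs, ht⟩, h⟩
    exact ⟨s, hs, t, ht, h⟩
  · rintro ⟨s, hs, t, ht, h⟩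
    exact ⟨s, t, ⟨hs, ht⟩, h⟩

theorem differences_map {G : Type*} {H : Type*} [Group G] [Group H] (e : G ≃* H) (S : Finset G) :
    differences (S.map e.toEquiv.toEmbedding) = (differences S).map e := by
  have h : S.map e.toEquiv.toEmbedding ×ˢ S.map e.toEquiv.toEmbedding =
      (S ×ˢ S).map (e.toEquiv.toEmbedding.prodMap e.toEquiv.toEmbedding) := by
    ext ⟨x, y⟩
    simp only [Finset.mem_product, Finset.mem_map, Function.Embedding.prodMap, Prod.exists]
    constructor
    · rintro ⟨⟨s, hs, rfl⟩, t, ht, rfl⟩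
      exact ⟨s, t, ⟨hs, ht⟩, rfl⟩
    · rintro ⟨s, t, ⟨hs, ht⟩, h⟩
      cases h
      exact ⟨⟨s, hs, rfl⟩, t, ht, rfl⟩
  rw [differences, h, Finset.map_val, Multiset.map_map, differences, Multiset.map_map]
  refine Multiset.map_congr rfl fun p _ => ?_
  exact ((map_mul e p.1 p.2⁻¹).trans (congrArg _ (map_inv e p.2))).symm

theorem isCoveringSet_map {G : Type*} {H : Type*} [Group G] [Group H] (e : G ≃* H) {S : Finset G} :
    IsCoveringSet (S.map e.toEquiv.toEmbedding) ↔ IsCoveringSet S := by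
  rw [IsCoveringSet, IsCoveringSet, differences_map, e.surjective.forall]
  exact forall_congr' fun g => Multiset.mem_map_of_injective e.injective

theorem inverseSet_map {G : Type*} {H : Type*} [Group G] [Group H] (e : G ≃* H) (S : Finset G) :
    inverseSet (S.map e.toEquiv.toEmbedding) = (inverseSet S).map e.toEquiv.toEmbedding := by
  rw [inverseSet, inverseSet, Finset.map_map, Finset.map_map]
  congr 1
  ext g
  exact (map_inv e g).symm

theorem gammaSet_map : gammaSet.map gammaEquiv.toEquiv.toEmbedding = coverSet := by
  have ha : gammaEquiv a = genA := toModel_a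
  have hb : gammaEquiv b = genB := toModel_b
  have h : ∀ g, gammaEquiv.toEquiv.toEmbedding g = gammaEquiv g := fun _ => rfl
  ext x
  simp only [gammaSet, coverSet, Finset.mem_map, Finset.mem_insert, Finset.mem_singleton, h]
  simp only [or_and_right, exists_or, exists_eq_left, map_mul, map_inv, map_pow, map_one, ha, hb,
    eq_comm]

theorem card_coverSet : coverSet.card = 7 := by decide +kernel

theorem coverSet_covers : ∀ g : Model, ∃ s ∈ coverSet, ∃ t ∈ coverSet, s * t⁻¹ = g := by
  decide +kernel

theorem coverSet_inverse_covers :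
    ∀ g : Model, ∃ s ∈ coverSet, ∃ t ∈ coverSet, s⁻¹ * t = g := by
  decide +kernel

theorem coverSet_count :
    ∀ g : Model, g ≠ 1 → (differences coverSet).count g ≠ 1 →
      (differences coverSet).count g = 1 + 1 := by
  decide +kernel

theorem coverSet_count_one :
    (Finset.univ.filter fun g : Model => g ≠ 1 ∧ (differences coverSet).count g = 1).card = 36 := by
  decide +kernel

theorem card_gamma : Nat.card Gamma = 40 :=
  (Nat.card_congr gammaEquiv.toEquiv).trans card_eq

theorem isNonAbelian_gamma : IsNonAbelian Gamma := by
  refine ⟨a, b, fun h => ?_⟩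
  have h' := congrArg toModel h
  rw [map_mul, map_mul, toModel_a, toModel_b] at h'
  revert h'
  decide +kernel

theorem card_gammaSet : gammaSet.card = 7 := by
  rw [← card_coverSet, ← gammaSet_map, Finset.card_map]

theorem isCoveringSet_gammaSet : IsCoveringSet gammaSet := by
  rw [← isCoveringSet_map gammaEquiv, gammaSet_map]
  exact fun g => mem_differences.2 (coverSet_covers g)

theorem isCoveringSet_inverseSet_gammaSet : IsCoveringSet (inverseSet gammaSet) := by
  rw [← isCoveringSet_map gammaEquiv, ← inverseSet_map, gammaSet_map]
  intro g
  obtain ⟨s, hs, t, ht, h⟩ := coverSet_inverse_covers g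
  exact mem_differences.2 ⟨s⁻¹, Finset.mem_map_of_mem _ hs, t⁻¹, Finset.mem_map_of_mem _ ht,
    by rwa [inv_inv]⟩

open Classical in
theorem count_gammaSet (g : Gamma) :
    (differences gammaSet).count g = (differences coverSet).count (gammaEquiv g) := by
  rw [← gammaSet_map, differences_map, Multiset.count_map_eq_count' _ _ gammaEquiv.injective]

theorem isAlmostDifferenceSet_gammaSet : IsAlmostDifferenceSet gammaSet 40 7 1 36 where
  finite := Finite.of_equiv _ gammaEquiv.toEquiv.symm
  order := card_gamma
  size := card_gammaSet
  count_eq := by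
    classical
    rw [← coverSet_count_one, ← Set.ncard_coe_finset,
      ← Set.ncard_image_of_injective _ gammaEquiv.injective]
    congr 1
    ext x
    obtain ⟨g, rfl⟩ := gammaEquiv.surjective x
    rw [gammaEquiv.injective.mem_set_image]
    simp only [Set.mem_ofPred_eq, Finset.coe_filter, Finset.mem_univ, true_and, ne_eq,
      EmbeddingLike.map_eq_one_iff]
    convert Iff.rfl using 3
    convert (count_gammaSet g).symm
  count_other := by
    classical
    intro g hg h
    have := coverSet_count (gammaEquiv g) (by simpa using hg)
    convert this ?_ using 1
    · convert count_gammaSet g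
    · intro h'
      apply h
      rw [← h']
      convert count_gammaSet g

/-! ### Counting representations as differences -/

section Counting

variable {G : Type u} [Group G] [DecidableEq G]

/-- The number of pairs of elements of `S` with difference `g`. -/
def pairCount (S : Finset G) (g : G) : ℕ := ((S ×ˢ S).filter fun p => p.1 * p.2⁻¹ = g).card

theorem sum_pairCount (S : Finset G) (T : Finset G) :
    ∑ g ∈ T, pairCount S g = ((S ×ˢ S).filter fun p => p.1 * p.2⁻¹ ∈ T).card := by
  rw [Finset.card_eq_sum_card_fiberwise (f := fun p : G × G => p.1 * p.2⁻¹) (t := T)]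
  · refine Finset.sum_congr rfl fun g hg => ?_
    rw [pairCount, Finset.filter_filter]
    congr 1
    refine Finset.filter_congr fun p _ => ?_
    exact ⟨fun h => ⟨h ▸ hg, h⟩, fun h => h.2⟩
  · intro p hp
    exact (Finset.mem_filter.1 hp).2

theorem pairCount_one (S : Finset G) : pairCount S 1 = S.card := by
  rw [pairCount, ← Finset.diag_card S]
  congr 1
  ext ⟨x, y⟩
  simp only [Finset.mem_filter, Finset.mem_product, Finset.mem_diag, mul_inv_eq_one]
  exact ⟨fun h => ⟨h.1.1, h.2⟩, fun h => ⟨⟨h.1, h.2 ▸ h.1⟩, h.2⟩⟩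

theorem IsCoveringSet.one_le_pairCount {S : Finset G} (hS : IsCoveringSet S) (g : G) :
    1 ≤ pairCount S g := by
  obtain ⟨s, hs, t, ht, h⟩ := mem_differences.1 (hS g)
  exact Finset.card_pos.2 ⟨(s, t), by simp [hs, ht, h]⟩

theorem IsCoveringSet.two_le_pairCount {S : Finset G} (hS : IsCoveringSet S) {z : G}
    (hz : z ≠ 1) (hzz : z * z = 1) : 2 ≤ pairCount S z := by
  obtain ⟨s, hs, t, ht, h⟩ := mem_differences.1 (hS z)
  refine Finset.one_lt_card.2 ⟨(s, t), by simp [hs, ht, h], (t, s), ?_, ?_⟩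
  · simp only [Finset.mem_filter, Finset.mem_product, hs, ht, true_and]
    rw [← inv_inj, mul_inv_rev, inv_inv, h, inv_eq_of_mul_eq_one_left hzz]
  · rintro ⟨⟩
    exact hz (by rw [← h, mul_inv_cancel])

variable [Fintype G]

theorem sum_pairCount_univ (S : Finset G) : ∑ g, pairCount S g = S.card * S.card := by
  rw [sum_pairCount, ← Finset.card_product]
  simp

theorem IsCoveringSet.card_le {S : Finset G} (hS : IsCoveringSet S) :
    Fintype.card G + S.card ≤ S.card * S.card + 1 := by
  have h := Finset.add_sum_erase Finset.univ (pairCount S) (Finset.mem_univ 1)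
  have h' : (Finset.univ.erase (1 : G)).card • 1 ≤ ∑ g ∈ Finset.univ.erase 1, pairCount S g :=
    Finset.card_nsmul_le_sum _ _ _ fun g _ => hS.one_le_pairCount g
  have h0 : 0 < Fintype.card G := Fintype.card_pos
  rw [sum_pairCount_univ, pairCount_one] at h
  rw [Finset.card_erase_of_mem (Finset.mem_univ _), Finset.card_univ, smul_eq_mul] at h'
  omega

/-- If the number of pairs of distinct elements equals the order of the group, a covering set
represents one involution twice and every other nonidentity element once. -/
theorem IsCoveringSet.pairCount_eq {S : Finset G} (hS : IsCoveringSet S)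
    (hcard : Fintype.card G + S.card = S.card * S.card) {z : G} (hz : z ≠ 1) (hzz : z * z = 1)
    (g : G) : pairCount S g = 1 + (if g = 1 then S.card - 1 else 0) + if g = z then 1 else 0 := by
  -- Under `hcard` these lower bounds add up to the total number of pairs, so each of them is
  -- attained.
  have hle : ∀ g ∈ Finset.univ, 1 + (if g = 1 then S.card - 1 else 0) + (if g = z then 1 else 0)
      ≤ pairCount S g := by
    intro g _
    by_cases h1 : g = 1
    · subst h1
      have := hS.one_le_pairCount 1
      rw [pairCount_one] at this ⊢
      simp only [if_true, if_neg hz.symm]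
      omega
    · by_cases h2 : g = z
      · subst h2
        simpa [h1] using hS.two_le_pairCount hz hzz
      · simpa [h1, h2] using hS.one_le_pairCount g
  have h0 := hS.one_le_pairCount 1
  rw [pairCount_one] at h0
  refine ((Finset.sum_eq_sum_iff_of_le hle).1 ?_ g (Finset.mem_univ g)).symm
  rw [sum_pairCount_univ, Finset.sum_add_distrib, Finset.sum_add_distrib, Finset.sum_ite_eq',
    Finset.sum_ite_eq', Finset.sum_const, Finset.card_univ]
  simp only [Finset.mem_univ, if_true, smul_eq_mul]
  omega

theorem IsCoveringSet.involution_unique {S : Finset G} (hS : IsCoveringSet S)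
    (hcard : Fintype.card G + S.card = S.card * S.card) {z w : G} (hz : z ≠ 1) (hzz : z * z = 1)
    (hw : w ≠ 1) (hww : w * w = 1) : w = z := by
  by_contra h
  have h1 := hS.pairCount_eq hcard hz hzz w
  have h2 := hS.two_le_pairCount hw hww
  rw [h1, if_neg hw, if_neg h] at h2
  omega

end Counting

/-! ### Fibre sizes over an abelian quotient -/

section Quotient

variable {G : Type u} [Group G] [DecidableEq G] [Fintype G] {A : Type*} [AddCommGroup A]
  [DecidableEq A]

/-- The number of elements of `S` in a fiber of a homomorphism. -/
def fiberCount (f : G →* Multiplicative A) (S : Finset G) (i : A) : ℕ :=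
  (S.filter fun s => (f s).toAdd = i).card

/-- Both sides count the pairs `(s, t)` in `S` whose images differ by `r`; the left side sorts them
by the image of `t`. -/
theorem sum_fiberCount_mul [Fintype A] (f : G →* Multiplicative A) (S : Finset G) (r : A) :
    ∑ i, fiberCount f S (i + r) * fiberCount f S i =
      ∑ g with (f g).toAdd = r, pairCount S g := by
  rw [sum_pairCount, Finset.card_eq_sum_card_fiberwise (f := fun p : G × G => (f p.2).toAdd)
    (t := Finset.univ) (fun _ _ => Finset.mem_coe.2 (Finset.mem_univ _))]
  refine Finset.sum_congr rfl fun i _ => ?_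
  rw [fiberCount, fiberCount, ← Finset.card_product]
  congr 1
  ext ⟨s, t⟩
  simp only [Finset.mem_product, Finset.mem_filter, Finset.mem_univ, true_and, map_mul, map_inv,
    toAdd_mul, toAdd_inv, ← sub_eq_add_neg, sub_eq_iff_eq_add']
  constructor
  · rintro ⟨⟨hs, h⟩, ht, rfl⟩
    exact ⟨⟨⟨hs, ht⟩, h⟩, rfl⟩
  · rintro ⟨⟨⟨hs, ht⟩, h⟩, rfl⟩
    exact ⟨⟨hs, h⟩, ht, rfl⟩

end Quotient

theorem card_fiber_mul_card {G : Type u} [Group G] [Fintype G] {A : Type*} [AddCommGroup A]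
    [DecidableEq A] [Fintype A] {f : G →* Multiplicative A} (hf : Function.Surjective f)
    (r : A) :
    (Finset.univ.filter fun g => (f g).toAdd = r).card * Fintype.card A =
      Fintype.card G := by
  have h := Finset.card_eq_sum_card_fiberwise (f := fun g => (f g).toAdd) (s := Finset.univ)
    (t := Finset.univ) (fun _ _ => Finset.mem_coe.2 (Finset.mem_univ _))
  rw [Finset.card_univ] at h
  rw [h, Finset.sum_congr rfl fun i _ => ?_, Finset.sum_const, smul_eq_mul, mul_comm,
    Finset.card_univ]
  exact MonoidHom.card_fiber_eq_of_mem_range f (hf (Multiplicative.ofAdd i))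
    (hf (Multiplicative.ofAdd r))

/-! ### Exclusion of order 42 -/

/-- A group of order `42` with a unique involution maps onto `ℤ/6` so that the involution does not
become trivial. -/
theorem exists_hom_zmod_six {G : Type u} [Group G] [Finite G] (hG : Nat.card G = 42) {z : G}
    (hz : z ≠ 1) (hzz : z * z = 1) (huniq : ∀ w : G, w ≠ 1 → w * w = 1 → w = z) :
    ∃ f : G →* Multiplicative (ZMod 6), Function.Surjective f ∧ (f z).toAdd = 3 := by
  have : Fact (Nat.Prime 7) := ⟨by norm_num⟩
  have : Fact (Nat.Prime 3) := ⟨by norm_num⟩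
  -- A conjugate of `z` is again an involution, hence `z` itself.
  have hcentral : ∀ g : G, g * z = z * g := by
    intro g
    have h := huniq (g * z * g⁻¹) (by simpa using hz) (by
      rw [show g * z * g⁻¹ * (g * z * g⁻¹) = g * (z * z) * g⁻¹ by group, hzz]; group)
    exact mul_inv_eq_iff_eq_mul.1 h
  obtain ⟨P⟩ : Nonempty (Sylow 7 G) := inferInstance
  have hfac : (42 : ℕ).factorization 7 = 1 := by
    rw [show 42 = 7 * 6 by norm_num, Nat.factorization_mul_apply_of_coprime (by norm_num),
      Nat.Prime.factorization_self (by norm_num),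
      Nat.factorization_eq_zero_of_not_dvd (by norm_num)]
  have hP : Nat.card P = 7 := by rw [P.card_eq_multiplicity, hG, hfac, pow_one]
  have hindex : (P : Subgroup G).index = 6 := by
    have h := (P : Subgroup G).card_mul_index
    rw [hG, hP] at h
    omega
  have hsylow : Nat.card (Sylow 7 G) = 1 := by
    have h1 := card_sylow_modEq_one 7 G
    have h2 : Nat.card (Sylow 7 G) ∣ 6 := hindex ▸ P.card_dvd_index
    have h3 := Nat.le_of_dvd (by norm_num) h2
    rw [Nat.ModEq] at h1
    omega
  have : Subsingleton (Sylow 7 G) := (Nat.card_eq_one_iff_unique.1 hsylow).1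
  have : (P : Subgroup G).Normal := P.normal_of_subsingleton
  let π := QuotientGroup.mk' (P : Subgroup G)
  have hQ : Nat.card (G ⧸ (P : Subgroup G)) = 6 := hindex
  have hπz : π z ≠ 1 := by
    intro h
    have hmem : z ∈ (P : Subgroup G) := (QuotientGroup.eq_one_iff z).1 h
    have h7 := (P : Subgroup G).orderOf_dvd_natCard hmem
    rw [hP, orderOf_eq_prime (pow_two z ▸ hzz) hz] at h7
    omega
  have hπzz : π z * π z = 1 := by rw [← map_mul, hzz, map_one]
  obtain ⟨c, hc⟩ := exists_prime_orderOf_dvd_card' (G := G ⧸ (P : Subgroup G)) 3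
    (by rw [hQ]; norm_num)
  have hcomm : Commute (π z) c := by
    obtain ⟨g, rfl⟩ := QuotientGroup.mk'_surjective _ c
    change π z * π g = π g * π z
    rw [← map_mul, ← map_mul, hcentral]
  have horder : orderOf (π z) = 2 := orderOf_eq_prime (pow_two (π z) ▸ hπzz) hπz
  -- The central involution times an element of order 3 has order 6; centrality excludes the
  -- symmetric group as quotient.
  have : IsCyclic (G ⧸ (P : Subgroup G)) := isCyclic_of_orderOf_eq_card (π z * c) (by
    rw [hcomm.orderOf_mul_eq_mul_orderOf_of_coprime (by rw [horder, hc]; norm_num), horder, hc, hQ])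
  let e : (G ⧸ (P : Subgroup G)) ≃* Multiplicative (ZMod 6) :=
    ((hQ ▸ zmodCyclicMulEquiv (G := G ⧸ (P : Subgroup G)) inferInstance).symm)
  refine ⟨e.toMonoidHom.comp π, e.surjective.comp (QuotientGroup.mk'_surjective _), ?_⟩
  have h3 : ∀ w : ZMod 6, w ≠ 0 → w + w = 0 → w = 3 := by decide
  apply h3
  · exact fun h => hπz ((map_eq_one_iff e e.injective).1 (toAdd_eq_zero.1 h))
  · change (e (π z)).toAdd + (e (π z)).toAdd = 0
    rw [← toAdd_mul, ← map_mul, hπzz, map_one, toAdd_one]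

/-- Squares adding to 5 must be 4, 1 and 0 in some order, so exactly one of the three products is
nonzero. -/
theorem not_sum_sq_eq_five {x y z : ℤ} (h : x * y + y * z = z * x) :
    x ^ 2 + y ^ 2 + z ^ 2 ≠ 5 := by
  intro h5
  have hx : -2 ≤ x ∧ x ≤ 2 := by constructor <;> nlinarith [sq_nonneg y, sq_nonneg z]
  have hy : -2 ≤ y ∧ y ≤ 2 := by constructor <;> nlinarith [sq_nonneg x, sq_nonneg z]
  have hz : -2 ≤ z ∧ z ≤ 2 := by constructor <;> nlinarith [sq_nonneg x, sq_nonneg y]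
  obtain ⟨hx1, hx2⟩ := hx
  obtain ⟨hy1, hy2⟩ := hy
  obtain ⟨hz1, hz2⟩ := hz
  interval_cases x <;> interval_cases y <;> interval_cases z <;>
    first | (norm_num at h; done) | norm_num at h5

theorem not_isCoveringSet_of_card_eq_42 {G : Type u} [Group G] (hG : Nat.card G = 42)
    {S : Finset G} (hcard : S.card = 7) : ¬ IsCoveringSet S := by
  classical
  intro hS
  have : Finite G := Nat.finite_of_card_ne_zero (by omega)
  have : Fintype G := Fintype.ofFinite G
  have hG' : Fintype.card G = 42 := by rw [← Nat.card_eq_fintype_card, hG]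
  have hsum : Fintype.card G + S.card = S.card * S.card := by rw [hG', hcard]
  have : Fact (Nat.Prime 2) := ⟨Nat.prime_two⟩
  obtain ⟨z, horder⟩ := exists_prime_orderOf_dvd_card' (G := G) 2 (by rw [hG]; norm_num)
  have hz : z ≠ 1 := by
    rintro rfl
    simp at horder
  have hzz : z * z = 1 := by rw [← pow_two, ← horder, pow_orderOf_eq_one]
  obtain ⟨f, hf, hfz⟩ := exists_hom_zmod_six hG hz hzz fun w hw hww =>
    hS.involution_unique hsum hz hzz hw hww
  -- Each fibre has 7 elements; the identity, counted 7 times, adds 6 over 0, and `z`, counted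
  -- twice, adds 1 over 3.
  have key : ∀ r : ZMod 6, ∑ i, fiberCount f S (i + r) * fiberCount f S i =
      7 + (if r = 0 then 6 else 0) + if r = 3 then 1 else 0 := by
    intro r
    have hfiber := card_fiber_mul_card hf r
    rw [hG', ZMod.card] at hfiber
    rw [sum_fiberCount_mul, Finset.sum_congr rfl fun g _ => hS.pairCount_eq hsum hz hzz g,
      Finset.sum_add_distrib, Finset.sum_add_distrib, Finset.sum_ite_eq', Finset.sum_ite_eq',
      Finset.sum_const, smul_eq_mul, hcard,
      show (Finset.univ.filter fun g => (f g).toAdd = r).card = 7 by omega]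
    simp only [Finset.mem_filter, Finset.mem_univ, true_and, map_one, toAdd_one, hfz,
      eq_comm (b := r)]
  have hexp : ∀ r : ZMod 6, ∑ i, fiberCount f S (i + r) * fiberCount f S i =
      fiberCount f S (0 + r) * fiberCount f S 0 + fiberCount f S (1 + r) * fiberCount f S 1 +
      fiberCount f S (2 + r) * fiberCount f S 2 + fiberCount f S (3 + r) * fiberCount f S 3 +
      fiberCount f S (4 + r) * fiberCount f S 4 + fiberCount f S (5 + r) * fiberCount f S 5 :=
    fun r => Fin.sum_univ_six (fun i : ZMod 6 => fiberCount f S (i + r) * fiberCount f S i)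
  generalize fiberCount f S = n at key hexp
  have h0 : n 0 * n 0 + n 1 * n 1 + n 2 * n 2 + n 3 * n 3 + n 4 * n 4 + n 5 * n 5 = 13 :=
    (hexp 0).symm.trans (key 0)
  have h1 : n 1 * n 0 + n 2 * n 1 + n 3 * n 2 + n 4 * n 3 + n 5 * n 4 + n 0 * n 5 = 7 :=
    (hexp 1).symm.trans (key 1)
  have h2 : n 2 * n 0 + n 3 * n 1 + n 4 * n 2 + n 5 * n 3 + n 0 * n 4 + n 1 * n 5 = 7 :=
    (hexp 2).symm.trans (key 2)
  have h3 : n 3 * n 0 + n 4 * n 1 + n 5 * n 2 + n 0 * n 3 + n 1 * n 4 + n 2 * n 5 = 8 :=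
    (hexp 3).symm.trans (key 3)
  zify at h0 h1 h2 h3
  -- Differences of opposite fibres: the sum of squares is 13 - 8, and the mixed terms give 7 - 7.
  refine not_sum_sq_eq_five (x := (n 0 : ℤ) - n 3) (y := (n 1 : ℤ) - n 4) (z := (n 2 : ℤ) - n 5)
    ?_ ?_
  · linear_combination h1 - h2
  · linear_combination h0 - h3

/-! ### The upper bound and its attainment -/

theorem IsNonAbelian.not_prime_card {G : Type u} [Group G] (hG : IsNonAbelian G) :
    ¬ (Nat.card G).Prime := by
  intro hp
  have : Fact (Nat.card G).Prime := ⟨hp⟩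
  have : IsCyclic G := isCyclic_of_prime_card rfl
  obtain ⟨x, y, h⟩ := hG
  exact h (IsCyclic.isMulCommutative.is_comm.comm x y)

theorem card_le_of_isNonAbelian {G : Type u} [Group G] [Finite G] (hG : IsNonAbelian G)
    {S : Finset G} (hcard : S.card = 7) (hS : IsCoveringSet S) : Nat.card G ≤ 40 := by
  classical
  have : Fintype G := Fintype.ofFinite G
  have hle := hS.card_le
  rw [hcard, ← Nat.card_eq_fintype_card] at hle
  have hprime := hG.not_prime_card
  have h41 : Nat.card G ≠ 41 := fun h => hprime (h ▸ by norm_num)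
  have h43 : Nat.card G ≠ 43 := fun h => hprime (h ▸ by norm_num)
  have h42 : Nat.card G ≠ 42 := fun h => not_isCoveringSet_of_card_eq_42 h hcard hS
  omega

theorem forty_mem_nonAbelianCoveringOrders : 40 ∈ nonAbelianCoveringOrders.{u} 7 := by
  -- `Gamma` lives in the lowest universe, so it is lifted to `u`.
  let e : Gamma ≃* ULift.{u} Gamma := MulEquiv.ulift.symm
  refine ⟨ULift.{u} Gamma, inferInstance, ?_, ?_, ?_, gammaSet.map e.toEquiv.toEmbedding, ?_, ?_⟩
  · have := isAlmostDifferenceSet_gammaSet.finite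
    infer_instance
  · rw [← Nat.card_congr e.toEquiv, card_gamma]
  · obtain ⟨x, y, h⟩ := isNonAbelian_gamma
    exact ⟨e x, e y, fun h' => h (e.injective (by rw [map_mul, map_mul, h']))⟩
  · rw [Finset.card_map, card_gammaSet]
  · exact (isCoveringSet_map e).2 isCoveringSet_gammaSet

end CoveringSets

theorem mainTheorem8 :
    -- the maximum order of a non-Abelian group with a covering 7-set is 40
    IsGreatest (CoveringSets.nonAbelianCoveringOrders.{u} 7) 40 ∧
    -- no non-Abelian group of order 42 has a covering 7-set
    (∀ (G : Type u) [Group G], Nat.card G = 42 → CoveringSets.IsNonAbelian G →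
      ¬ ∃ S : Finset G, S.card = 7 ∧ CoveringSets.IsCoveringSet S) ∧
    -- the explicit group of order 40 and its covering set
    Nat.card CoveringSets.Gamma = 40 ∧
    CoveringSets.IsNonAbelian CoveringSets.Gamma ∧
    CoveringSets.gammaSet.card = 7 ∧
    CoveringSets.IsCoveringSet CoveringSets.gammaSet ∧
    CoveringSets.IsAlmostDifferenceSet CoveringSets.gammaSet 40 7 1 36 ∧
    CoveringSets.IsCoveringSet (CoveringSets.inverseSet CoveringSets.gammaSet) := by
  refine ⟨⟨CoveringSets.forty_mem_nonAbelianCoveringOrders, ?_⟩, ?_, CoveringSets.card_gamma,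
    CoveringSets.isNonAbelian_gamma, CoveringSets.card_gammaSet,
    CoveringSets.isCoveringSet_gammaSet, CoveringSets.isAlmostDifferenceSet_gammaSet,
    CoveringSets.isCoveringSet_inverseSet_gammaSet⟩
  · rintro n ⟨G, _, _, rfl, hG, S, hcard, hS⟩
    exact CoveringSets.card_le_of_isNonAbelian hG hcard hS
  · rintro G _ hcard _ ⟨S, hS, hS'⟩
    exact CoveringSets.not_isCoveringSet_of_card_eq_42 hcard hS hS'
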